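/- Let $G$ be a finite group. For $a=\sum_g a_g g$ and $b=\sum_g b_g g$ in $\mathbb{C}G$ the Hadamard product is $a\circ b=\sum_g a_gb_g g$, with unit $\sum_g g$. A supercharacter theory of $G$ is a subspace $\mathsf{S}\subseteq Z(\mathbb{C}G)$ that is a unital subalgebra both for the ordinary product (so $1\in\mathsf S$) and for the Hadamard product (so $\sum_g g\in\mathsf S$). With respect to each of the two products $\mathsf{S}$ has a unique basis of orthogonal (equivalently, primitive) idempotents. For the Hadamard product these are the elements $\widehat K=\sum_{g\in K}g$ for $K$ in a partition $\mathrm{Cl}(\mathsf S)$ of $G$, whose parts are called the $\mathsf{S}$-classes; $\mathrm{cl}_{\mathsf S}(g)$ denotes the $\mathsf{S}$-class containing $g$. For the ordinary product these are the elements $\sum_{\psi\in X}e_\psi$ for $X$ in a partition $\mathrm{Ch}(\mathsf S)$ of the set $\mathrm{Irr}(G)$ of complex irreducible characters, where $e_\psi=\frac{1}{|G|}\sum_{g\in G}\psi(1)\psi(g^{-1})g$. The basic $\mathsf{S}$-characters are the characters $\sigma_X=\sum_{\psi\in X}\psi(1)\psi$ with $X\in\mathrm{Ch}(\mathsf S)$;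 their set is denoted by $\mathrm{BCh}(\mathsf S)$. Theorem. Let $\mathsf{S}$ be a supercharacter theory of the finite group $G$. Let $C\subseteq G$ be a set of representatives of the $\mathsf{S}$-classes, let $x_g$ $(g\in C)$ be independent indeterminates, and let $\kappa:G\to C$ send each element of $G$ to the representative in $C$ of its $\mathsf{S}$-class. Let $\Theta_{\mathsf S}=\det\bigl(x_{\kappa(gh^{-1})}\bigr)_{g,h\in G}$. Then, in the polynomial ring $\mathbb{C}[x_g : g\in C]$, \[\Theta_{\mathsf S}=\prod_{\chi\in\mathrm{BCh}(\mathsf S)}\left(\sum_{g\in C}\frac{\chi(g)\,|\mathrm{cl}_{\mathsf S}(g)|}{\chi(1)}\,x_g\right)^{\chi(1)}.\] -/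

import Mathlib

/-- A supercharacter theory of a finite group `G`: a subspace of the centre of `ℂ[G]` which is a
unital subalgebra both for the ordinary product and for the Hadamard (coefficientwise) product,
whose unit is `∑ g, g`. -/
structure SupercharacterTheory (G : Type*) [Group G] [Fintype G]
    extends Subalgebra ℂ (MonoidAlgebra ℂ G) where
  le_center : toSubalgebra ≤ Subalgebra.center ℂ (MonoidAlgebra ℂ G)
  hadamard_one_mem : (∑ g : G, MonoidAlgebra.single g (1 : ℂ)) ∈ carrier
  hadamard_mul_mem : ∀ {a b : MonoidAlgebra ℂ G}, a ∈ carrier → b ∈ carrier →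
    (∑ g : G, MonoidAlgebra.single g (a.coeff g * b.coeff g)) ∈ carrier

namespace SupercharacterTheory

variable {G : Type*} [Group G] [Fintype G]

/-- The sum `K̂ = ∑_{g ∈ K} g` in `ℂ[G]`. The elements of this form are exactly the idempotents
of `ℂ[G]` for the Hadamard product. -/
noncomputable def setSum (K : Set G) : MonoidAlgebra ℂ G :=
  ∑ g : G, MonoidAlgebra.single g (K.indicator 1 g)

/-- The set `Irr(G)` of complex irreducible characters of `G`. -/
def irr (G : Type*) [Group G] : Set (G → ℂ) :=
  {ψ | ∃ (n : ℕ) (ρ : Representation ℂ G (Fin n → ℂ)), ρ.IsIrreducible ∧ ρ.character = ψ}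

/-- The element `e_ψ = |G|⁻¹ ∑_g ψ(1) ψ(g⁻¹) g` of `ℂ[G]`; for irreducible `ψ` these are the
primitive idempotents of the centre of `ℂ[G]`. -/
noncomputable def charIdempotent (ψ : G → ℂ) : MonoidAlgebra ℂ G :=
  ∑ g : G, MonoidAlgebra.single g (ψ 1 * ψ g⁻¹ / (Fintype.card G : ℂ))

/-- `σ_X = ∑_{ψ ∈ X} ψ(1) ψ`. -/
noncomputable def sigma (X : Finset (G → ℂ)) : G → ℂ :=
  ∑ ψ ∈ X, ψ 1 • ψ

/-- `Cl(S)`: the `S`-classes, that is, the sets `K` for which `K̂` is a primitive idempotent of `S`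
for the Hadamard product (these `K̂` are the basis of orthogonal idempotents of `S` for that
product). -/
def superclasses (S : SupercharacterTheory G) : Set (Set G) :=
  {K | Minimal (fun L : Set G => L.Nonempty ∧ setSum L ∈ S.toSubalgebra) K}

/-- `cl_S(g)`: the `S`-class containing `g`. -/
def cl (S : SupercharacterTheory G) (g : G) : Set G :=
  {h | ∃ K ∈ S.superclasses, g ∈ K ∧ h ∈ K}

/-- `Ch(S)`: the sets `X` of irreducible characters for which `∑_{ψ ∈ X} e_ψ` is a primitive
idempotent of `S` for the ordinary product (these sums are the basis of orthogonal idempotents of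
`S` for that product). -/
def charParts (S : SupercharacterTheory G) : Set (Finset (G → ℂ)) :=
  {X | Minimal (fun Y : Finset (G → ℂ) => (Y : Set (G → ℂ)) ⊆ irr G ∧ Y.Nonempty ∧
    ∑ ψ ∈ Y, charIdempotent ψ ∈ S.toSubalgebra) X}

/-- `BCh(S)`: the basic `S`-characters `σ_X`, for `X ∈ Ch(S)`. -/
def basicChars (S : SupercharacterTheory G) : Set (G → ℂ) :=
  sigma '' S.charParts

/-- `C` contains exactly one element of each `S`-class. -/
def IsClassReps (S : SupercharacterTheory G) (C : Finset G) : Prop :=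
  ∀ K ∈ S.superclasses, ∃! g, g ∈ C ∧ g ∈ K

/-- The degree `χ(1)` as a natural number; see `natCast_degree`. -/
noncomputable def degree (χ : G → ℂ) : ℕ := ⌊(χ 1).re⌋₊

/-- The `S`-classes partition `G`. -/
theorem isPartition_superclasses (S : SupercharacterTheory G) :
    Setoid.IsPartition S.superclasses := by
  classical
  have coeffS : ∀ (L : Set G) (g : G), (setSum L).coeff g = L.indicator 1 g := by
    intro L g
    simp [setSum, MonoidAlgebra.coeff_sum, Finsupp.finsetSum_apply, Finsupp.single_apply]
  have hinter : ∀ K L : Set G, setSum K ∈ S.toSubalgebra → setSum L ∈ S.toSubalgebra →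
      setSum (K ∩ L) ∈ S.toSubalgebra := by
    intro K L hK hL
    have h := S.hadamard_mul_mem hK hL
    have e : (∑ g : G, MonoidAlgebra.single g ((setSum K).coeff g * (setSum L).coeff g))
        = setSum (K ∩ L) := by
      simp only [coeffS]
      refine Finset.sum_congr rfl fun g _ => ?_
      rw [Set.inter_indicator_one]
      rfl
    rw [e] at h
    exact h
  have hdiff : ∀ K L : Set G, L ⊆ K → setSum K ∈ S.toSubalgebra → setSum L ∈ S.toSubalgebra →
      setSum (K \ L) ∈ S.toSubalgebra := by
    intro K L hLK hK hL
    have h := S.toSubalgebra.sub_mem hK hL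
    have e : setSum K - setSum L = setSum (K \ L) := by
      rw [setSum, setSum, setSum, ← Finset.sum_sub_distrib]
      refine Finset.sum_congr rfl fun g _ => ?_
      rw [← MonoidAlgebra.single_sub]
      congr 1
      by_cases h1 : g ∈ L
      · simp [h1, hLK h1]
      · by_cases h2 : g ∈ K <;> simp [h1, h2]
    rwa [e] at h
  refine ⟨fun h => Set.not_nonempty_empty h.1.1, fun g => ?_⟩
  have huniv : setSum (Set.univ : Set G) ∈ S.toSubalgebra := by
    simpa [setSum] using S.hadamard_one_mem
  obtain ⟨K, hK⟩ := (Set.toFinite {L : Set G | g ∈ L ∧ setSum L ∈ S.toSubalgebra}).exists_minimal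
    ⟨Set.univ, Set.mem_univ g, huniv⟩
  have hKc : K ∈ S.superclasses := by
    refine ⟨⟨⟨g, hK.prop.1⟩, hK.prop.2⟩, fun L hL hLK => ?_⟩
    by_cases hg : g ∈ L
    · exact hK.2 ⟨hg, hL.2⟩ hLK
    · have hKL : g ∈ K \ L ∧ setSum (K \ L) ∈ S.toSubalgebra :=
        ⟨⟨hK.prop.1, hg⟩, hdiff K L hLK hK.prop.2 hL.2⟩
      have := hK.2 hKL Set.sdiff_subset
      obtain ⟨y, hy⟩ := hL.1
      exact absurd hy (this (hLK hy)).2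
  refine ⟨K, ⟨hKc, hK.prop.1⟩, ?_⟩
  rintro L ⟨hL, hgL⟩
  have hI : (K ∩ L).Nonempty ∧ setSum (K ∩ L) ∈ S.toSubalgebra :=
    ⟨⟨g, hK.prop.1, hgL⟩, hinter K L hK.prop.2 hL.1.2⟩
  exact Set.Subset.antisymm (fun x hx => (hL.2 hI Set.inter_subset_right hx).1)
    (fun x hx => (hKc.2 hI Set.inter_subset_left hx).2)

/-- `Irr(G)` is finite. -/
theorem finite_irr (G : Type*) [Group G] [Fintype G] : (irr G).Finite := by
  classical
  have : Invertible (Nat.card G : ℂ) := invertibleOfNonzero (by simp)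
  have horth : ∀ ψ ∈ irr G, ∀ φ ∈ irr G,
      (Nat.card G : ℂ)⁻¹ * ∑ g : G, ψ g * φ g⁻¹ = if ψ = φ then 1 else 0 := by
    rintro _ ⟨n, ρ, hρ, rfl⟩ _ ⟨m, τ, hτ, rfl⟩
    have key := Representation.char_orthonormal ρ τ
    have key2 := Representation.char_orthonormal τ τ
    rw [if_pos ⟨Representation.Equiv.refl τ⟩] at key2
    by_cases h : ρ.character = τ.character
    · rw [if_pos h, h, key2]
    · rw [if_neg h, key, if_neg]
      rintro ⟨e⟩
      exact h (Representation.char_iso e).symm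
  have hli : LinearIndependent ℂ (fun ψ : irr G => (ψ : G → ℂ)) := by
    rw [linearIndependent_iff']
    intro s c hc i hi
    have h0 : ∑ j ∈ s, c j * ((Nat.card G : ℂ)⁻¹ * ∑ g : G, j.1 g * i.1 g⁻¹) = 0 := by
      have : ∀ g : G, ∑ j ∈ s, c j * j.1 g = 0 := fun g => by
        simpa using congrFun hc g
      calc _ = (Nat.card G : ℂ)⁻¹ * ∑ g : G, (∑ j ∈ s, c j * j.1 g) * i.1 g⁻¹ := by
            simp only [Finset.mul_sum, Finset.sum_mul]
            rw [Finset.sum_comm]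
            refine Finset.sum_congr rfl fun _ _ => Finset.sum_congr rfl fun _ _ => by ring
        _ = 0 := by simp [this]
    rw [Finset.sum_congr rfl fun j _ => by rw [horth _ j.2 _ i.2]] at h0
    simpa [Subtype.coe_inj, hi] using h0
  exact hli.setFinite

/-- `BCh(S)` is finite. -/
theorem finite_basicChars (S : SupercharacterTheory G) : S.basicChars.Finite := by
  classical
  refine Set.Finite.image _ (((finite_irr G).toFinset.powerset.finite_toSet).subset fun X hX => ?_)
  simpa [Finset.subset_iff, Set.subset_def] using hX.1.1

/-- For a basic `S`-character `χ`, the number `χ(1)` is a positive integer. -/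
theorem natCast_degree (S : SupercharacterTheory G) {χ : G → ℂ} (hχ : χ ∈ S.basicChars) :
    (degree χ : ℂ) = χ 1 ∧ 0 < degree χ := by
  obtain ⟨X, hX, rfl⟩ := hχ
  have hn : ∀ ψ ∈ X, ∃ n : ℕ, 0 < n ∧ ψ 1 = n := by
    intro ψ hψ
    obtain ⟨n, ρ, hρ, rfl⟩ := hX.1.1 hψ
    refine ⟨n, Nat.pos_of_ne_zero ?_, by simp⟩
    rintro rfl
    obtain ⟨a, b, hab⟩ := hρ.toNontrivial
    exact hab (SetLike.ext fun x => by
      rw [Subsingleton.elim x 0]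
      exact iff_of_true a.toSubmodule.zero_mem b.toSubmodule.zero_mem)
  choose! n hpos hn using hn
  have h : sigma X 1 = ((∑ ψ ∈ X, n ψ * n ψ : ℕ) : ℂ) := by
    rw [sigma, Finset.sum_apply]
    push_cast
    exact Finset.sum_congr rfl fun ψ hψ => by simp [hn ψ hψ]
  have hd : degree (sigma X) = ∑ ψ ∈ X, n ψ * n ψ := by
    rw [degree, h, Complex.natCast_re, Nat.floor_natCast]
  rw [hd]
  exact ⟨h.symm, Finset.sum_pos (fun ψ hψ => Nat.mul_pos (hpos ψ hψ) (hpos ψ hψ)) hX.1.2.1⟩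

end SupercharacterTheory

/-!
Evaluating the indeterminates turns the determinant into the norm of a central element `a ∈ S` of
the algebra `ℂ[G]`. The orthogonal idempotents `e_ψ` decompose `ℂ[G]` into blocks of dimension
`ψ(1)²`, and a central `a` acts on the block of `ψ` as the scalar `ω_ψ(a)`, so its norm is
`∏_ψ ω_ψ(a) ^ ψ(1)²`. For `a ∈ S` the function `ψ ↦ ω_ψ(a)` is constant on each part `X ∈ Ch(S)`,
and `∑_{ψ ∈ X} ψ(1)² = σ_X(1)`, so collecting factors gives one power for each basic character.

Both kinds of idempotents are instances of one fact: an algebra of functions on a finite set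
consists of all functions that are constant on the classes of points it does not separate. It is
applied to `S` as an algebra of functions on `G` (Hadamard product) and on `Irr(G)` (ordinary
product). That `σ_X` is itself constant on the `S`-classes follows because `ψ(g⁻¹)` is the complex
conjugate of `ψ(g)`, which makes `σ_X / |G|` the conjugate of the coefficient function of
`∑_{ψ ∈ X} e_ψ ∈ S`.
-/

section FunctionAlgebra

variable {ι F : Type*} [Field F]

/-- The equivalence relation on `ι` of not being separated by the functions in `A`. Its classes are
the supports of the primitive idempotents of `A`, see `minimal_indicator_mem_iff`. -/
def nonseparated (A : Subalgebra F (ι → F)) : Setoid ι where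
  r i j := ∀ f ∈ A, f i = f j
  iseqv := ⟨fun _ _ _ => rfl, fun h f hf => (h f hf).symm,
    fun h h' f hf => (h f hf).trans (h' f hf)⟩

variable {A : Subalgebra F (ι → F)}

theorem exists_mem_eq_one_eq_zero {i j : ι} (h : ¬ nonseparated A i j) :
    ∃ f ∈ A, f i = 1 ∧ f j = 0 := by
  obtain ⟨f, hf, hij⟩ : ∃ f ∈ A, f i ≠ f j := by
    by_contra! hij
    exact h hij
  refine ⟨(f i - f j)⁻¹ • (f - algebraMap F _ (f j)),
    A.smul_mem (A.sub_mem hf (A.algebraMap_mem _)) _, ?_, ?_⟩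
  · simp [inv_mul_cancel₀ (sub_ne_zero.2 hij)]
  · simp

theorem indicator_nonseparated_mem [Finite ι] (i : ι) :
    ({j | nonseparated A j i} : Set ι).indicator 1 ∈ A := by
  classical
  have := Fintype.ofFinite ι
  have hsep : ∀ j, ∃ f ∈ A, f i = 1 ∧ (¬ nonseparated A j i → f j = 0) := fun j => by
    by_cases hj : nonseparated A j i
    · exact ⟨1, A.one_mem, rfl, fun h => absurd hj h⟩
    · obtain ⟨f, hf, hi, hj⟩ := exists_mem_eq_one_eq_zero fun h => hj ((nonseparated A).symm' h)
      exact ⟨f, hf, hi, fun _ => hj⟩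
  choose f hfA hfi hfj using hsep
  have hprod : ∏ j, f j ∈ A := A.prod_mem fun j _ => hfA j
  convert hprod using 1
  ext j
  by_cases hj : nonseparated A j i
  · rw [Set.indicator_of_mem hj, hj _ hprod, Finset.prod_apply]
    simp [hfi]
  · rw [Set.indicator_of_notMem hj, Finset.prod_apply, Finset.prod_eq_zero (Finset.mem_univ j)]
    exact hfj j hj

theorem nonseparated_class_subset {L : Set ι} (hL : L.indicator 1 ∈ A) {i : ι} (hi : i ∈ L) :
    {j | nonseparated A j i} ⊆ L := by
  intro j hj
  by_contra hjL
  simpa [hi, hjL] using hj _ hL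

theorem minimal_indicator_mem_iff [Finite ι] {K : Set ι} :
    Minimal (fun L : Set ι => L.Nonempty ∧ L.indicator 1 ∈ A) K ↔ K ∈ (nonseparated A).classes := by
  constructor
  · intro hK
    obtain ⟨i, hi⟩ := hK.prop.1
    have hi_class : ({j | nonseparated A j i} : Set ι).Nonempty := ⟨i, (nonseparated A).refl' i⟩
    exact ⟨i, (hK.eq_of_subset ⟨hi_class, indicator_nonseparated_mem i⟩
      (nonseparated_class_subset hK.prop.2 hi)).symm⟩
  · rintro ⟨i, rfl⟩
    refine ⟨⟨⟨i, (nonseparated A).refl' i⟩, indicator_nonseparated_mem i⟩, ?_⟩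
    rintro L ⟨⟨j, hj⟩, hL⟩ hLi l hl
    exact nonseparated_class_subset hL hj
      ((nonseparated A).trans' hl ((nonseparated A).symm' (hLi hj)))

theorem mem_iff_forall_nonseparated [Finite ι] {f : ι → F} :
    f ∈ A ↔ ∀ i j, nonseparated A i j → f i = f j := by
  classical
  refine ⟨fun hf i j hij => hij f hf, fun hf => ?_⟩
  have := Fintype.ofFinite (Quotient (nonseparated A))
  have hout (j : ι) (q : Quotient (nonseparated A)) : nonseparated A j q.out ↔ ⟦j⟧ = q := by
    rw [← Quotient.eq, Quotient.out_eq]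
  have hsum : f = ∑ q : Quotient (nonseparated A),
      f q.out • ({j | nonseparated A j q.out} : Set ι).indicator 1 := by
    ext j
    simp [Set.indicator_apply, hout, hf _ _ (Quotient.mk_out (s := nonseparated A) j)]
  rw [hsum]
  exact A.sum_mem fun q _ => A.smul_mem (indicator_nonseparated_mem _) _

end FunctionAlgebra

section IdempotentNorm

variable {k : Type*} [Field k]

theorem det_one_add_smul_of_isProj {V : Type*} [AddCommGroup V] [Module k V]
    [FiniteDimensional k V] {p : Submodule k V} {f : V →ₗ[k] V} (h : LinearMap.IsProj p f)
    (t : k) : LinearMap.det (1 + t • f) = (1 + t) ^ Module.finrank k p := by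
  have hd : 1 + t • f = (p.prodEquivOfIsCompl (LinearMap.ker f) h.isCompl).conj
      (LinearMap.prodMap ((1 + t) • LinearMap.id) LinearMap.id) := by
    conv_lhs => rw [h.eq_conj_prodMap]
    rw [← map_smul, Module.End.one_eq_id, ← LinearEquiv.conj_id
      (p.prodEquivOfIsCompl (LinearMap.ker f) h.isCompl), ← map_add]
    congr 1
    ext x <;> simp [add_smul]
  rw [hd, LinearEquiv.conj_apply, LinearMap.comp_assoc, LinearMap.det_conj,
    LinearMap.det_prodMap, LinearMap.det_smul, LinearMap.det_id, LinearMap.det_id, mul_one,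
    mul_one]

variable {A : Type*} [Ring A] [Algebra k A]

/-- The algebra homomorphism `k^ι → A` attached to a complete family of orthogonal idempotents
of `A`. -/
noncomputable def idempotentHom {ι : Type*} [Fintype ι] {e : ι → A}
    (he : CompleteOrthogonalIdempotents e) : (ι → k) →ₐ[k] A :=
  AlgHom.ofLinearMap (Fintype.linearCombination k e)
    (by simpa [Fintype.linearCombination_apply] using he.complete)
    (fun c d => by
      classical
      simp [Fintype.linearCombination_apply, Finset.sum_mul_sum, he.mul_eq, mul_smul,
        smul_comm (d _)])

theorem idempotentHom_apply {ι : Type*} [Fintype ι] {e : ι → A}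
    (he : CompleteOrthogonalIdempotents e) (c : ι → k) :
    idempotentHom he c = ∑ i, c i • e i := rfl

variable [FiniteDimensional k A]

theorem norm_one_add_smul_of_isIdempotentElem {e : A} (he : IsIdempotentElem e) (t : k) :
    Algebra.norm k (1 + t • e) =
      (1 + t) ^ Module.finrank k (LinearMap.mulLeft k e).range := by
  have hproj := LinearMap.IsIdempotentElem.isProj_range _ (he.map (Algebra.lmul k A))
  rw [Algebra.norm_apply, map_add, map_one, map_smul]
  exact det_one_add_smul_of_isProj hproj t

theorem norm_one_add_sum_smul_of_orthogonalIdempotents {ι : Type*} {e : ι → A}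
    (he : OrthogonalIdempotents e) (t : ι → k) (s : Finset ι) :
    Algebra.norm k (1 + ∑ i ∈ s, t i • e i) =
      ∏ i ∈ s, (1 + t i) ^ Module.finrank k (LinearMap.mulLeft k (e i)).range := by
  classical
  induction s using Finset.induction_on with
  | empty => simp
  | insert i s hi ih =>
    have horth : e i * ∑ j ∈ s, t j • e j = 0 := by
      rw [Finset.mul_sum]
      refine Finset.sum_eq_zero fun j hj => ?_
      rw [mul_smul_comm, he.ortho (ne_of_mem_of_not_mem hj hi).symm, smul_zero]
    have hfactor : 1 + ∑ j ∈ insert i s, t j • e j =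
        (1 + t i • e i) * (1 + ∑ j ∈ s, t j • e j) := by
      rw [Finset.sum_insert hi, add_mul, one_mul, smul_mul_assoc, mul_add, horth, mul_one,
        add_zero]
      abel
    rw [hfactor, map_mul, ih, Finset.prod_insert hi,
      norm_one_add_smul_of_isIdempotentElem (he.idem i)]

theorem norm_idempotentHom {ι : Type*} [Fintype ι] {e : ι → A}
    (he : CompleteOrthogonalIdempotents e) (c : ι → k) :
    Algebra.norm k (idempotentHom he c) =
      ∏ i, c i ^ Module.finrank k (LinearMap.mulLeft k (e i)).range := by
  have hc : idempotentHom he c = 1 + ∑ i, (c i - 1) • e i := by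
    rw [← map_one (idempotentHom (k := k) he), idempotentHom_apply, idempotentHom_apply,
      ← Finset.sum_add_distrib]
    exact Finset.sum_congr rfl fun i _ => by rw [← add_smul]; simp
  rw [hc, norm_one_add_sum_smul_of_orthogonalIdempotents he.toOrthogonalIdempotents]
  simp

end IdempotentNorm

section GroupAlgebra

open scoped MonoidAlgebra

variable {k G : Type*}

theorem mem_center_iff_coeff_conj [CommSemiring k] [Group G] {a : k[G]} :
    a ∈ Subalgebra.center k k[G] ↔ ∀ g x : G, a.coeff (x * g * x⁻¹) = a.coeff g := by
  rw [Subalgebra.mem_center_iff]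
  constructor
  · intro h g x
    have := congrArg (fun b => b.coeff (x * g)) (h (MonoidAlgebra.single x 1))
    simpa using this.symm
  · intro h b
    induction b using MonoidAlgebra.induction_linear with
    | zero => simp
    | add b c hb hc => rw [add_mul, mul_add, hb, hc]
    | single x r =>
      ext g
      have hg := h (x⁻¹ * g) x
      simp_all [mul_comm]

variable [Fintype G]

/-- The element of `k[G]` with a given coefficient function. -/
noncomputable def ofCoeff [Semiring k] (f : G → k) : k[G] :=
  ∑ g : G, MonoidAlgebra.single g (f g)

@[simp]
theorem coeff_ofCoeff [Semiring k] (f : G → k) (g : G) : (ofCoeff f).coeff g = f g := by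
  classical
  simp [ofCoeff, MonoidAlgebra.coeff_sum, Finsupp.finsetSum_apply, Finsupp.single_apply]

@[simp]
theorem ofCoeff_coeff [Semiring k] (a : k[G]) : ofCoeff a.coeff = a := by
  ext g
  exact coeff_ofCoeff _ g

variable [Group G]

theorem coeff_mul_eq_sum [Semiring k] (a b : k[G]) (g : G) :
    (a * b).coeff g = ∑ h : G, a.coeff h * b.coeff (h⁻¹ * g) := by
  conv_lhs => rw [← ofCoeff_coeff a]
  simp [ofCoeff, Finset.sum_mul, MonoidAlgebra.coeff_sum, Finsupp.finsetSum_apply]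

theorem asAlgebraHom_eq_sum [CommSemiring k] {V : Type*} [AddCommMonoid V] [Module k V]
    (ρ : Representation k G V) (a : k[G]) : ρ.asAlgebraHom a = ∑ g : G, a.coeff g • ρ g := by
  conv_lhs => rw [← ofCoeff_coeff a]
  simp [ofCoeff]

variable [CommRing k]

theorem leftMulMatrix_basis [DecidableEq G] (a : k[G]) :
    Algebra.leftMulMatrix (MonoidAlgebra.basis G k) a =
      Matrix.of fun g h => a.coeff (g * h⁻¹) := by
  ext g h
  simp [Algebra.leftMulMatrix_eq_repr_mul, MonoidAlgebra.basis]

theorem norm_eq_det_coeff [DecidableEq G] (a : k[G]) :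
    Algebra.norm k a = (Matrix.of fun g h => a.coeff (g * h⁻¹)).det := by
  rw [Algebra.norm_eq_matrix_det (MonoidAlgebra.basis G k), leftMulMatrix_basis]

theorem trace_mulLeft (a : k[G]) :
    LinearMap.trace k k[G] (LinearMap.mulLeft k a) = Fintype.card G * a.coeff 1 := by
  classical
  have := congrArg Matrix.trace (leftMulMatrix_basis a)
  rw [LinearMap.trace_eq_matrix_trace k (MonoidAlgebra.basis G k)]
  refine this.trans ?_
  simp [Matrix.trace]

end GroupAlgebra

section SimpleModule

theorem eq_zero_of_mem_annihilator_of_isSimpleModule {R : Type*} [Ring R] [IsSemisimpleRing R]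
    {a : R} (h : ∀ N : Submodule R R, IsSimpleModule R N → a ∈ N.annihilator) : a = 0 := by
  have hann : a ∈ (⊤ : Submodule R R).annihilator := by
    rw [← IsSemisimpleModule.sSup_simples_eq_top, sSup_eq_iSup', Submodule.annihilator_iSup,
      Submodule.mem_iInf]
    exact fun N => h N N.2
  simpa using Submodule.mem_annihilator.1 hann 1 trivial

open scoped MonoidAlgebra

theorem asAlgebraHom_ofModule' {k G M : Type*} [CommSemiring k] [Monoid G] [AddCommMonoid M]
    [Module k M] [Module k[G] M] [IsScalarTower k k[G] M] (a : k[G]) (x : M) :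
    (Representation.ofModule' M).asAlgebraHom a x = a • x := by
  simp [Representation.ofModule', Representation.asAlgebraHom]

theorem isIrreducible_ofModule' {k G M : Type*} [Field k] [Monoid G] [AddCommGroup M] [Module k M]
    [Module k[G] M] [IsScalarTower k k[G] M] [IsSimpleModule k[G] M] :
    (Representation.ofModule' (k := k) (G := G) M).IsIrreducible := by
  rw [Representation.irreducible_iff_isSimpleModule_asModule]
  exact IsSimpleModule.congr (N := M)
    { (Representation.ofModule' (k := k) (G := G) M).asModuleEquiv with
      map_smul' := fun a _ => asAlgebraHom_ofModule' a _ }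

end SimpleModule

namespace SupercharacterTheory

open scoped MonoidAlgebra

section Irreducible

variable {G : Type*} [Group G] {V : Type*} [AddCommGroup V] [Module ℂ V] [FiniteDimensional ℂ V]

theorem finrank_pos_of_isIrreducible (ρ : Representation ℂ G V) [ρ.IsIrreducible] :
    0 < Module.finrank ℂ V := by
  have : Nontrivial ρ.asModule := IsSimpleModule.nontrivial ℂ[G] _
  have : Nontrivial V := ρ.asModuleEquiv.symm.toEquiv.nontrivial
  exact Module.finrank_pos

theorem character_mem_irr (ρ : Representation ℂ G V) [hρ : ρ.IsIrreducible] :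
    ρ.character ∈ irr G := by
  let e : V ≃ₗ[ℂ] (Fin (Module.finrank ℂ V) → ℂ) := (Module.finBasis ℂ V).equivFun
  let σ : Representation ℂ G (Fin (Module.finrank ℂ V) → ℂ) :=
    (e.conjAlgEquiv ℂ : Module.End ℂ V →* Module.End ℂ _).comp ρ
  let E : ρ.Equiv σ := .mk e fun g => by ext v; simp [σ]
  have hE : Function.Bijective (Representation.IntertwiningMap.equivLinearMapAsModule ρ σ
      E.toIntertwiningMap) :=
    e.bijective
  refine ⟨_, σ, ?_, (Representation.char_iso E).symm⟩
  rw [Representation.irreducible_iff_isSimpleModule_asModule] at hρ ⊢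
  exact IsSimpleModule.congr (LinearEquiv.ofBijective _ hE).symm

theorem natCast_degree_of_mem_irr {ψ : G → ℂ} (hψ : ψ ∈ irr G) : (degree ψ : ℂ) = ψ 1 := by
  obtain ⟨n, ρ, -, rfl⟩ := hψ
  simp [degree]

theorem conj_apply_one_of_mem_irr {ψ : G → ℂ} (hψ : ψ ∈ irr G) : (starRingEnd ℂ) (ψ 1) = ψ 1 := by
  rw [← natCast_degree_of_mem_irr hψ, Complex.conj_natCast]

theorem apply_one_ne_zero_of_mem_irr {ψ : G → ℂ} (hψ : ψ ∈ irr G) : ψ 1 ≠ 0 := by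
  obtain ⟨n, ρ, hρ, rfl⟩ := hψ
  rw [Representation.char_one, Nat.cast_ne_zero]
  exact (finrank_pos_of_isIrreducible ρ).ne'

end Irreducible

section CentralChar

variable {G : Type*} [Group G] [Fintype G]

/-- The functional `ω_ψ(a) = ψ(1)⁻¹ ∑_g a_g ψ(g)` on `ℂ[G]`. For irreducible `ψ` it is the central
character of `ψ`, that is, a central `a` acts in a representation with character `ψ` as the
scalar `ω_ψ(a)`. -/
noncomputable def centralChar (ψ : G → ℂ) : ℂ[G] →ₗ[ℂ] ℂ where
  toFun a := (∑ g : G, a.coeff g * ψ g) / ψ 1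
  map_add' a b := by simp [add_mul, Finset.sum_add_distrib, add_div]
  map_smul' c a := by simp [mul_assoc, ← Finset.mul_sum, mul_div_assoc]

theorem centralChar_apply (ψ : G → ℂ) (a : ℂ[G]) :
    centralChar ψ a = (∑ g : G, a.coeff g * ψ g) / ψ 1 := rfl

@[simp]
theorem coeff_charIdempotent (ψ : G → ℂ) (g : G) :
    (charIdempotent ψ).coeff g = ψ 1 * ψ g⁻¹ / Fintype.card G :=
  coeff_ofCoeff _ g

section Schur

variable {V : Type*} [AddCommGroup V] [Module ℂ V]

theorem trace_asAlgebraHom (ρ : Representation ℂ G V) (a : ℂ[G]) :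
    LinearMap.trace ℂ V (ρ.asAlgebraHom a) = ∑ g : G, a.coeff g * ρ.character g := by
  simp [asAlgebraHom_eq_sum, Representation.character]

theorem asAlgebraHom_eq_centralChar_smul [FiniteDimensional ℂ V] (ρ : Representation ℂ G V)
    [ρ.IsIrreducible] {a : ℂ[G]} (ha : a ∈ Subalgebra.center ℂ ℂ[G]) :
    ρ.asAlgebraHom a = centralChar ρ.character a • 1 := by
  obtain ⟨c, hc⟩ :=
    Representation.IsIrreducible.algebraMap_intertwiningMap_bijective_of_isAlgClosed.2
      (Representation.IntertwiningMap.centralAlgebraMul ρ ha)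
  have hscalar : ρ.asAlgebraHom a = c • 1 :=
    (congrArg Representation.IntertwiningMap.toLinearMap hc).symm
  have hdim : (Module.finrank ℂ V : ℂ) ≠ 0 :=
    Nat.cast_ne_zero.2 (finrank_pos_of_isIrreducible ρ).ne'
  have htrace := trace_asAlgebraHom ρ a
  rw [hscalar, map_smul, LinearMap.trace_one, smul_eq_mul] at htrace
  rw [hscalar, centralChar_apply, ← htrace, Representation.char_one, mul_div_cancel_right₀ c hdim]

end Schur

theorem eq_zero_of_centralChar_eq_zero {a : ℂ[G]} (ha : a ∈ Subalgebra.center ℂ ℂ[G])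
    (h : ∀ ψ ∈ irr G, centralChar ψ a = 0) : a = 0 := by
  refine eq_zero_of_mem_annihilator_of_isSimpleModule fun N hN => ?_
  have : FiniteDimensional ℂ N := inferInstanceAs (FiniteDimensional ℂ (N.restrictScalars ℂ))
  let ρ : Representation ℂ G N := Representation.ofModule' N
  have : ρ.IsIrreducible := isIrreducible_ofModule'
  have hzero : ρ.asAlgebraHom a = 0 := by
    rw [asAlgebraHom_eq_centralChar_smul ρ ha, h _ (character_mem_irr ρ), zero_smul]
  refine Submodule.mem_annihilator.2 fun x hx => congrArg Subtype.val
    (show a • (⟨x, hx⟩ : N) = 0 from ?_)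
  rw [← asAlgebraHom_ofModule' (k := ℂ) (G := G)]
  exact LinearMap.congr_fun hzero _

theorem centralChar_one {ψ : G → ℂ} (hψ : ψ 1 ≠ 0) : centralChar ψ 1 = 1 := by
  classical
  rw [centralChar_apply, div_eq_one_iff_eq hψ, Finset.sum_eq_single 1 _ (by simp)]
  · simp [MonoidAlgebra.one_def]
  · intro g _ hg
    simp [MonoidAlgebra.one_def, hg.symm]

theorem charIdempotent_mem_center {ψ : G → ℂ} (hψ : ψ ∈ irr G) :
    charIdempotent ψ ∈ Subalgebra.center ℂ ℂ[G] := by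
  obtain ⟨n, ρ, -, rfl⟩ := hψ
  refine mem_center_iff_coeff_conj.2 fun g x => ?_
  rw [coeff_charIdempotent, coeff_charIdempotent, show (x * g * x⁻¹)⁻¹ = x * g⁻¹ * x⁻¹ by group,
    Representation.char_conj]

theorem mul_charIdempotent {ψ : G → ℂ} (hψ : ψ ∈ irr G) {a : ℂ[G]}
    (ha : a ∈ Subalgebra.center ℂ ℂ[G]) :
    a * charIdempotent ψ = centralChar ψ a • charIdempotent ψ := by
  obtain ⟨n, ρ, hρ, rfl⟩ := hψ
  ext g
  have htrace : ∑ x, a.coeff x * ρ.character (g⁻¹ * x) =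
      centralChar ρ.character a * ρ.character g⁻¹ := by
    have := congrArg (fun T => LinearMap.trace ℂ (Fin n → ℂ) (ρ g⁻¹ * T))
      (asAlgebraHom_eq_centralChar_smul ρ ha)
    simpa [asAlgebraHom_eq_sum, Finset.mul_sum, Representation.character] using this
  rw [coeff_mul_eq_sum, MonoidAlgebra.coeff_smul_apply, smul_eq_mul]
  simp only [coeff_charIdempotent, mul_inv_rev, inv_inv]
  rw [mul_div_assoc', mul_left_comm, ← htrace, Finset.mul_sum, Finset.sum_div]
  exact Finset.sum_congr rfl fun x _ => by ring

open Classical in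
theorem sum_mul_inv_of_mem_irr {ψ φ : G → ℂ} (hψ : ψ ∈ irr G) (hφ : φ ∈ irr G) :
    (Fintype.card G : ℂ)⁻¹ * ∑ g : G, ψ g * φ g⁻¹ = if ψ = φ then 1 else 0 := by
  have : Invertible (Nat.card G : ℂ) := invertibleOfNonzero (by simp)
  obtain ⟨n, ρ, hρ, rfl⟩ := hψ
  obtain ⟨m, τ, hτ, rfl⟩ := hφ
  rw [Fintype.card_eq_nat_card]
  split_ifs with h
  · rw [h, Representation.char_orthonormal, if_pos ⟨Representation.Equiv.refl τ⟩]
  · rw [Representation.char_orthonormal, if_neg]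
    exact fun ⟨e⟩ => h (Representation.char_iso e).symm

open Classical in
theorem centralChar_charIdempotent {ψ φ : G → ℂ} (hψ : ψ ∈ irr G) (hφ : φ ∈ irr G) :
    centralChar ψ (charIdempotent φ) = if ψ = φ then 1 else 0 := by
  have h : centralChar ψ (charIdempotent φ) =
      φ 1 / ψ 1 * ((Fintype.card G : ℂ)⁻¹ * ∑ g : G, ψ g * φ g⁻¹) := by
    simp only [centralChar_apply, coeff_charIdempotent, Finset.mul_sum, Finset.sum_div]
    exact Finset.sum_congr rfl fun g _ => by ring
  rw [h, sum_mul_inv_of_mem_irr hψ hφ]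
  split_ifs with heq
  · rw [heq, div_self (apply_one_ne_zero_of_mem_irr hφ), one_mul]
  · rw [mul_zero]

noncomputable instance : Fintype (irr G) := (finite_irr G).fintype

theorem eq_sum_centralChar_smul {a : ℂ[G]} (ha : a ∈ Subalgebra.center ℂ ℂ[G]) :
    a = ∑ ψ : irr G, centralChar (ψ : G → ℂ) a • charIdempotent (ψ : G → ℂ) := by
  classical
  rw [← sub_eq_zero]
  refine eq_zero_of_centralChar_eq_zero (Subalgebra.sub_mem _ ha (Subalgebra.sum_mem _
    fun ψ _ => Subalgebra.smul_mem _ (charIdempotent_mem_center ψ.2) _)) fun φ hφ => ?_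
  lift φ to irr G using hφ
  simp [fun ψ : irr G => centralChar_charIdempotent φ.2 ψ.2, Subtype.coe_inj]

theorem completeOrthogonalIdempotents_charIdempotent :
    CompleteOrthogonalIdempotents fun ψ : irr G => charIdempotent (ψ : G → ℂ) where
  idem ψ := by
    classical
    rw [IsIdempotentElem, mul_charIdempotent ψ.2 (charIdempotent_mem_center ψ.2),
      centralChar_charIdempotent ψ.2 ψ.2, if_pos rfl, one_smul]
  ortho ψ φ h := by
    classical
    dsimp only
    rw [mul_charIdempotent φ.2 (charIdempotent_mem_center ψ.2),
      centralChar_charIdempotent φ.2 ψ.2, if_neg fun h' => h (Subtype.ext h'.symm), zero_smul]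
  complete := by
    rw [eq_sum_centralChar_smul (Subalgebra.one_mem _)]
    exact Finset.sum_congr rfl fun ψ _ => by
      rw [centralChar_one (apply_one_ne_zero_of_mem_irr ψ.2), one_smul]

/-- The algebra homomorphism `f ↦ ∑_ψ f(ψ) e_ψ`, an isomorphism of the functions on `Irr(G)` onto
the centre of `ℂ[G]`. -/
noncomputable def irrHom (G : Type*) [Group G] [Fintype G] : (irr G → ℂ) →ₐ[ℂ] ℂ[G] :=
  idempotentHom completeOrthogonalIdempotents_charIdempotent

theorem irrHom_apply (f : irr G → ℂ) :
    irrHom G f = ∑ ψ : irr G, f ψ • charIdempotent (ψ : G → ℂ) := rfl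

theorem centralChar_irrHom (f : irr G → ℂ) (ψ : irr G) :
    centralChar (ψ : G → ℂ) (irrHom G f) = f ψ := by
  classical
  simp [irrHom_apply, fun φ : irr G => centralChar_charIdempotent ψ.2 φ.2, Subtype.coe_inj]

theorem irrHom_centralChar {a : ℂ[G]} (ha : a ∈ Subalgebra.center ℂ ℂ[G]) :
    irrHom G (fun ψ => centralChar (ψ : G → ℂ) a) = a :=
  (eq_sum_centralChar_smul ha).symm

theorem finrank_range_mulLeft_charIdempotent (ψ : irr G) :
    Module.finrank ℂ (LinearMap.mulLeft ℂ (charIdempotent (ψ : G → ℂ))).range =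
      degree (ψ : G → ℂ) ^ 2 := by
  have hproj := LinearMap.IsIdempotentElem.isProj_range _
    ((completeOrthogonalIdempotents_charIdempotent.idem ψ).map (Algebra.lmul ℂ ℂ[G]))
  have htrace := (trace_mulLeft (charIdempotent (ψ : G → ℂ))).symm.trans hproj.trace
  rw [coeff_charIdempotent, inv_one, mul_div_cancel₀ _ (by simp),
    ← natCast_degree_of_mem_irr ψ.2] at htrace
  rw [sq]
  exact_mod_cast htrace.symm

theorem norm_eq_prod_irr {a : ℂ[G]} (ha : a ∈ Subalgebra.center ℂ ℂ[G]) :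
    Algebra.norm ℂ a = ∏ ψ : irr G, centralChar (ψ : G → ℂ) a ^ degree (ψ : G → ℂ) ^ 2 := by
  conv_lhs => rw [← irrHom_centralChar ha]
  rw [irrHom, norm_idempotentHom]
  exact Finset.prod_congr rfl fun ψ _ => by rw [finrank_range_mulLeft_charIdempotent]

end CentralChar

section Adjoint

variable {G : Type*} [Group G] [Fintype G]

/-- The conjugate-linear anti-involution of `ℂ[G]` that inverts the elements of `G`. -/
noncomputable def adjoint (a : ℂ[G]) : ℂ[G] := ofCoeff fun g => (starRingEnd ℂ) (a.coeff g⁻¹)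

@[simp]
theorem coeff_adjoint (a : ℂ[G]) (g : G) :
    (adjoint a).coeff g = (starRingEnd ℂ) (a.coeff g⁻¹) :=
  coeff_ofCoeff _ g

theorem adjoint_adjoint (a : ℂ[G]) : adjoint (adjoint a) = a := by
  ext g
  simp

theorem adjoint_smul (c : ℂ) (a : ℂ[G]) : adjoint (c • a) = (starRingEnd ℂ) c • adjoint a := by
  ext g
  simp

theorem adjoint_mul (a b : ℂ[G]) : adjoint (a * b) = adjoint b * adjoint a := by
  ext g
  rw [coeff_adjoint, coeff_mul_eq_sum, coeff_mul_eq_sum, map_sum]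
  refine Fintype.sum_equiv (Equiv.mulLeft g) _ _ fun x => ?_
  simp [mul_comm]

theorem adjoint_mem_center {a : ℂ[G]} (ha : a ∈ Subalgebra.center ℂ ℂ[G]) :
    adjoint a ∈ Subalgebra.center ℂ ℂ[G] := by
  rw [mem_center_iff_coeff_conj] at ha ⊢
  intro g x
  simpa [mul_assoc] using congrArg (starRingEnd ℂ) (ha g⁻¹ x)

theorem centralChar_adjoint_charIdempotent {ψ : G → ℂ} (hψ : ψ ∈ irr G) :
    centralChar ψ (adjoint (charIdempotent ψ)) =
      ((∑ g : G, Complex.normSq (ψ g)) / Fintype.card G : ℝ) := by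
  have h1 := apply_one_ne_zero_of_mem_irr hψ
  rw [centralChar_apply]
  push_cast
  rw [Finset.sum_div, Finset.sum_div]
  refine Finset.sum_congr rfl fun g _ => ?_
  simp only [coeff_adjoint, coeff_charIdempotent, inv_inv, Complex.normSq_eq_conj_mul_self,
    map_div₀, map_mul, conj_apply_one_of_mem_irr hψ, Complex.conj_natCast]
  field_simp

theorem adjoint_charIdempotent {ψ : G → ℂ} (hψ : ψ ∈ irr G) :
    adjoint (charIdempotent ψ) = charIdempotent ψ := by
  set r : ℝ := (∑ g : G, Complex.normSq (ψ g)) / Fintype.card G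
  have hr : (r : ℂ) ≠ 0 := by
    refine Complex.ofReal_ne_zero.2 (div_pos (Finset.sum_pos' (fun g _ => Complex.normSq_nonneg _)
      ⟨1, Finset.mem_univ _, ?_⟩) (Nat.cast_pos.2 Fintype.card_pos)).ne'
    exact Complex.normSq_pos.2 (apply_one_ne_zero_of_mem_irr hψ)
  have hmul : adjoint (charIdempotent ψ) * charIdempotent ψ = (r : ℂ) • charIdempotent ψ := by
    rw [mul_charIdempotent hψ (adjoint_mem_center (charIdempotent_mem_center hψ)),
      centralChar_adjoint_charIdempotent hψ]
  -- The left-hand side of `hmul` is self-adjoint, and the scalar on the right is real and nonzero.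
  have hself := congrArg adjoint hmul
  rw [adjoint_mul, adjoint_adjoint, adjoint_smul, Complex.conj_ofReal, hmul] at hself
  exact (smul_right_injective _ hr hself).symm

end Adjoint

theorem apply_inv_of_mem_irr {G : Type*} [Group G] [Finite G] {ψ : G → ℂ} (hψ : ψ ∈ irr G)
    (g : G) : ψ g⁻¹ = (starRingEnd ℂ) (ψ g) := by
  have := Fintype.ofFinite G
  have h := congrArg (fun a => a.coeff g) (adjoint_charIdempotent hψ)
  simpa [conj_apply_one_of_mem_irr hψ, mul_div_assoc, apply_one_ne_zero_of_mem_irr hψ,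
    div_left_inj'] using h.symm

section Hadamard

variable {G : Type*} [Group G] [Fintype G] (S : SupercharacterTheory G)

/-- The algebra `S` with the Hadamard product, as the algebra of coefficient functions of the
elements of `S`. -/
def hadamardAlgebra : Subalgebra ℂ (G → ℂ) where
  carrier := {f | ofCoeff f ∈ S.toSubalgebra}
  mul_mem' {f f'} hf hf' := by
    have h := S.hadamard_mul_mem (a := ofCoeff f) (b := ofCoeff f') hf hf'
    simp only [coeff_ofCoeff] at h
    exact h
  add_mem' {f f'} hf hf' := by
    simpa [ofCoeff, MonoidAlgebra.single_add, Finset.sum_add_distrib] using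
      S.toSubalgebra.add_mem hf hf'
  algebraMap_mem' c := by
    simpa [ofCoeff, Finset.smul_sum] using S.toSubalgebra.smul_mem S.hadamard_one_mem c

variable {S}

theorem mem_hadamardAlgebra {f : G → ℂ} : f ∈ S.hadamardAlgebra ↔ ofCoeff f ∈ S.toSubalgebra :=
  Iff.rfl

theorem coeff_mem_hadamardAlgebra {a : ℂ[G]} (ha : a ∈ S.toSubalgebra) :
    ⇑a.coeff ∈ S.hadamardAlgebra := by
  rwa [mem_hadamardAlgebra, ofCoeff_coeff]

theorem superclasses_eq_classes : S.superclasses = (nonseparated S.hadamardAlgebra).classes :=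
  Set.ext fun _ => minimal_indicator_mem_iff (A := S.hadamardAlgebra)

theorem mem_cl_iff {g h : G} : h ∈ S.cl g ↔ nonseparated S.hadamardAlgebra h g := by
  simp only [cl, superclasses_eq_classes]
  constructor
  · rintro ⟨_, ⟨k, rfl⟩, hg, hh⟩
    exact (nonseparated _).trans' hh ((nonseparated _).symm' hg)
  · exact fun hh => ⟨_, ⟨g, rfl⟩, (nonseparated _).refl' g, hh⟩

end Hadamard

section BasicCharacters

variable {G : Type*} [Group G] [Fintype G]

/-- The set `K` of irreducible characters as a finite set of functions on `G`, the form in which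
the elements of `Ch(S)` are given. -/
noncomputable def irrFinset : Set (irr G) ↪o Finset (G → ℂ) :=
  OrderEmbedding.ofMapLEIff (fun K => K.toFinite.toFinset.map (.subtype _)) (by simp)

theorem mem_irrFinset {K : Set (irr G)} {ψ : irr G} : (ψ : G → ℂ) ∈ irrFinset K ↔ ψ ∈ K := by
  simp [irrFinset]

theorem coe_irrFinset_subset (K : Set (irr G)) : (irrFinset K : Set (G → ℂ)) ⊆ irr G := by
  intro ψ
  simp only [irrFinset, OrderEmbedding.coe_ofMapLEIff, Finset.coe_map]
  rintro ⟨φ, -, rfl⟩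
  exact φ.2

theorem exists_irrFinset_eq {Y : Finset (G → ℂ)} (hY : (Y : Set (G → ℂ)) ⊆ irr G) :
    ∃ K, irrFinset K = Y := by
  refine ⟨{ψ | (ψ : G → ℂ) ∈ Y}, Finset.ext fun ψ => ⟨fun h => ?_, fun h => ?_⟩⟩
  · lift ψ to irr G using coe_irrFinset_subset _ h
    exact mem_irrFinset.1 h
  · lift ψ to irr G using hY h
    exact mem_irrFinset.2 h

theorem irrFinset_nonempty {K : Set (irr G)} : (irrFinset K).Nonempty ↔ K.Nonempty := by
  simp [irrFinset]

theorem sum_irrFinset {M : Type*} [AddCommMonoid M] (K : Set (irr G)) [DecidablePred (· ∈ K)]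
    (f : (G → ℂ) → M) :
    ∑ φ ∈ irrFinset K, f φ = ∑ φ : irr G with φ ∈ K, f φ := by
  rw [irrFinset, OrderEmbedding.coe_ofMapLEIff, Finset.sum_map]
  exact Finset.sum_congr (by ext; simp) fun _ _ => rfl

theorem irrHom_indicator (K : Set (irr G)) :
    irrHom G (K.indicator 1) = ∑ ψ ∈ irrFinset K, charIdempotent ψ := by
  classical
  rw [sum_irrFinset, irrHom_apply, Finset.sum_filter]
  exact Finset.sum_congr rfl fun ψ _ => by by_cases h : ψ ∈ K <;> simp [h]

theorem coeff_irrHom_indicator (K : Set (irr G)) (g : G) :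
    (irrHom G (K.indicator 1)).coeff g = sigma (irrFinset K) g⁻¹ / Fintype.card G := by
  simp [irrHom_indicator, MonoidAlgebra.coeff_sum, Finsupp.finsetSum_apply, sigma, Finset.sum_div]

theorem sigma_irrFinset_eq_conj (K : Set (irr G)) (g : G) :
    sigma (irrFinset K) g =
      Fintype.card G * (starRingEnd ℂ) ((irrHom G (K.indicator 1)).coeff g) := by
  have hinv : sigma (irrFinset K) g⁻¹ = (starRingEnd ℂ) (sigma (irrFinset K) g) := by
    simp only [sigma, Finset.sum_apply, Pi.smul_apply, smul_eq_mul, map_sum, map_mul]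
    refine Finset.sum_congr rfl fun φ hφ => ?_
    have hφ := coe_irrFinset_subset _ hφ
    rw [apply_inv_of_mem_irr hφ, conj_apply_one_of_mem_irr hφ]
  rw [coeff_irrHom_indicator, hinv, map_div₀, Complex.conj_conj, Complex.conj_natCast,
    mul_div_cancel₀ _ (by simp)]

theorem sigma_irrFinset_injective :
    Function.Injective fun K : Set (irr G) => sigma (irrFinset K) := by
  intro K L hKL
  have hirr : irrHom G (K.indicator 1) = irrHom G (L.indicator 1) := by
    ext g
    rw [coeff_irrHom_indicator, coeff_irrHom_indicator]
    exact congrArg (· g⁻¹ / (Fintype.card G : ℂ)) hKL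
  refine Set.indicator_one_inj ℂ (funext fun ψ => ?_)
  rw [← centralChar_irrHom (K.indicator 1), hirr, centralChar_irrHom]

theorem centralChar_sigma {X : Finset (G → ℂ)} {a : ℂ[G]} {c : ℂ} (hX : sigma X 1 ≠ 0)
    (h1 : ∀ φ ∈ X, φ 1 ≠ 0) (hc : ∀ φ ∈ X, centralChar φ a = c) : centralChar (sigma X) a = c := by
  have hterm : ∀ φ ∈ X, ∑ g : G, a.coeff g * φ g = c * φ 1 := fun φ hφ => by
    rw [← hc φ hφ, centralChar_apply, div_mul_cancel₀ _ (h1 φ hφ)]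
  rw [centralChar_apply, div_eq_iff hX]
  calc ∑ g : G, a.coeff g * sigma X g
      = ∑ φ ∈ X, φ 1 * ∑ g : G, a.coeff g * φ g := by
        simp only [sigma, Finset.sum_apply, Pi.smul_apply, smul_eq_mul, Finset.mul_sum]
        rw [Finset.sum_comm]
        exact Finset.sum_congr rfl fun _ _ => Finset.sum_congr rfl fun _ _ => by ring
    _ = ∑ φ ∈ X, φ 1 * (c * φ 1) := Finset.sum_congr rfl fun φ hφ => by rw [hterm φ hφ]
    _ = c * sigma X 1 := by
        simp only [sigma, Finset.sum_apply, Pi.smul_apply, smul_eq_mul, Finset.mul_sum]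
        exact Finset.sum_congr rfl fun _ _ => by ring

variable (S : SupercharacterTheory G)

/-- The algebra `S` with the ordinary product, as an algebra of functions on `Irr(G)`. -/
noncomputable def dualAlgebra : Subalgebra ℂ (irr G → ℂ) := S.toSubalgebra.comap (irrHom G)

/-- The basic `S`-character `σ_X` for the part `X` of `Irr(G)` containing `ψ`. -/
noncomputable def basicChar (ψ : irr G) : G → ℂ :=
  sigma (irrFinset {φ | nonseparated S.dualAlgebra φ ψ})

variable {S}

theorem centralChar_mem_dualAlgebra {a : ℂ[G]} (ha : a ∈ S.toSubalgebra) :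
    (fun ψ : irr G => centralChar (ψ : G → ℂ) a) ∈ S.dualAlgebra := by
  rwa [dualAlgebra, Subalgebra.mem_comap, irrHom_centralChar (S.le_center ha)]

theorem charParts_eq_image :
    S.charParts = irrFinset '' (nonseparated S.dualAlgebra).classes := by
  have hpart : {Y : Finset (G → ℂ) | (Y : Set (G → ℂ)) ⊆ irr G ∧ Y.Nonempty ∧
      ∑ ψ ∈ Y, charIdempotent ψ ∈ S.toSubalgebra} =
      irrFinset '' {K | K.Nonempty ∧ K.indicator 1 ∈ S.dualAlgebra} := by
    ext Y
    constructor
    · rintro ⟨hY, hne, hmem⟩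
      obtain ⟨K, rfl⟩ := exists_irrFinset_eq hY
      exact ⟨K, ⟨irrFinset_nonempty.1 hne, by rwa [dualAlgebra, Subalgebra.mem_comap,
        irrHom_indicator]⟩, rfl⟩
    · rintro ⟨K, ⟨hne, hmem⟩, rfl⟩
      exact ⟨coe_irrFinset_subset K, irrFinset_nonempty.2 hne, by
        rwa [dualAlgebra, Subalgebra.mem_comap, irrHom_indicator] at hmem⟩
  calc S.charParts = {X | Minimal (· ∈ irrFinset '' {K | K.Nonempty ∧
          K.indicator 1 ∈ S.dualAlgebra}) X} := by rw [← hpart]; rfl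
    _ = irrFinset '' {K | Minimal (fun L => L.Nonempty ∧ L.indicator 1 ∈ S.dualAlgebra) K} :=
        irrFinset.image_setOfPred_minimal.symm
    _ = irrFinset '' (nonseparated S.dualAlgebra).classes := by
        simp only [minimal_indicator_mem_iff, Set.ofPred_mem_eq]

theorem basicChars_eq_range : S.basicChars = Set.range S.basicChar := by
  ext χ
  simp [basicChars, charParts_eq_image, Setoid.classes, basicChar]

theorem basicChar_mem_basicChars (ψ : irr G) : S.basicChar ψ ∈ S.basicChars := by
  rw [basicChars_eq_range]
  exact Set.mem_range_self ψ

theorem basicChar_eq_iff {φ ψ : irr G} :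
    S.basicChar φ = S.basicChar ψ ↔ nonseparated S.dualAlgebra φ ψ := by
  rw [basicChar, basicChar, sigma_irrFinset_injective.eq_iff]
  refine ⟨fun h => h.subset ((nonseparated _).refl' φ), fun h => Set.ext fun θ => ?_⟩
  exact ⟨fun hθ => (nonseparated _).trans' hθ h,
    fun hθ => (nonseparated _).trans' hθ ((nonseparated _).symm' h)⟩

theorem centralChar_basicChar {a : ℂ[G]} (ha : a ∈ S.toSubalgebra) (ψ : irr G) :
    centralChar (S.basicChar ψ) a = centralChar (ψ : G → ℂ) a := by
  have hdeg := S.natCast_degree (basicChar_mem_basicChars ψ)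
  have hne : S.basicChar ψ 1 ≠ 0 := by
    rw [← hdeg.1, Nat.cast_ne_zero]
    exact hdeg.2.ne'
  refine centralChar_sigma hne
    (fun φ hφ => apply_one_ne_zero_of_mem_irr (coe_irrFinset_subset _ hφ)) fun φ hφ => ?_
  lift φ to irr G using coe_irrFinset_subset _ hφ
  exact mem_irrFinset.1 hφ _ (centralChar_mem_dualAlgebra ha)

open Classical in
theorem degree_basicChar (ψ : irr G) :
    degree (S.basicChar ψ) =
      ∑ φ : irr G with S.basicChar φ = S.basicChar ψ, degree (φ : G → ℂ) ^ 2 := by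
  apply Nat.cast_injective (R := ℂ)
  rw [(S.natCast_degree (basicChar_mem_basicChars ψ)).1]
  simp only [basicChar_eq_iff, Nat.cast_sum, Nat.cast_pow,
    natCast_degree_of_mem_irr (Subtype.prop _)]
  rw [basicChar, sigma, sum_irrFinset, Finset.sum_apply]
  simp [sq]

theorem norm_eq_prod_basicChars {a : ℂ[G]} (ha : a ∈ S.toSubalgebra) :
    Algebra.norm ℂ a = ∏ χ ∈ S.finite_basicChars.toFinset, centralChar χ a ^ degree χ := by
  classical
  rw [norm_eq_prod_irr (S.le_center ha), ← Finset.prod_fiberwise_of_maps_to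
    (t := S.finite_basicChars.toFinset) (g := S.basicChar)
    (by simp [basicChar_mem_basicChars])]
  refine Finset.prod_congr rfl fun χ hχ => ?_
  rw [Set.Finite.mem_toFinset, basicChars_eq_range] at hχ
  obtain ⟨ψ, rfl⟩ := hχ
  rw [degree_basicChar, ← Finset.prod_pow_eq_pow_sum]
  refine Finset.prod_congr rfl fun φ hφ => ?_
  rw [← (Finset.mem_filter.1 hφ).2, centralChar_basicChar ha]

theorem basicChar_mem_hadamardAlgebra (ψ : irr G) : S.basicChar ψ ∈ S.hadamardAlgebra := by
  refine mem_iff_forall_nonseparated.2 fun g h hgh => ?_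
  have hmem : irrHom G (({φ | nonseparated S.dualAlgebra φ ψ} : Set (irr G)).indicator 1) ∈
      S.toSubalgebra := indicator_nonseparated_mem (A := S.dualAlgebra) ψ
  rw [basicChar, sigma_irrFinset_eq_conj, sigma_irrFinset_eq_conj,
    hgh _ (coeff_mem_hadamardAlgebra hmem)]

end BasicCharacters

section ClassReps

variable {G : Type*} [Group G] [Fintype G] {S : SupercharacterTheory G} {C : Finset G}
  {κ : G → C}

theorem apply_eq_iff_mem_cl (hC : S.IsClassReps C) (hκ : ∀ g, (κ g : G) ∈ S.cl g) (g : G)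
    (k : C) : κ g = k ↔ g ∈ S.cl k := by
  simp only [mem_cl_iff] at hκ ⊢
  refine ⟨fun h => (nonseparated _).symm' (h ▸ hκ g), fun h => Subtype.ext ?_⟩
  have hK : {x | nonseparated S.hadamardAlgebra x k} ∈ S.superclasses := by
    rw [superclasses_eq_classes]
    exact Setoid.mem_classes _ _
  exact (hC _ hK).unique ⟨(κ g).2, (nonseparated _).trans' (hκ g) h⟩
    ⟨k.2, (nonseparated _).refl' _⟩

theorem comp_mem_hadamardAlgebra (hC : S.IsClassReps C) (hκ : ∀ g, (κ g : G) ∈ S.cl g)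
    (v : C → ℂ) : v ∘ κ ∈ S.hadamardAlgebra := by
  refine mem_iff_forall_nonseparated.2 fun g h hgh => congrArg v ?_
  rw [apply_eq_iff_mem_cl hC hκ, mem_cl_iff]
  exact (nonseparated _).trans' hgh ((nonseparated _).symm' (mem_cl_iff.1 (hκ h)))

theorem ncard_cl_eq_card_fiber (hC : S.IsClassReps C) (hκ : ∀ g, (κ g : G) ∈ S.cl g)
    [DecidableEq C] (k : C) : (S.cl k).ncard = (Finset.univ.filter fun g => κ g = k).card := by
  rw [← Set.ncard_coe_finset]
  congr 1
  ext g
  simp [apply_eq_iff_mem_cl hC hκ]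

theorem centralChar_ofCoeff_comp (hC : S.IsClassReps C) (hκ : ∀ g, (κ g : G) ∈ S.cl g)
    (v : C → ℂ) {χ : G → ℂ} (hχ : χ ∈ S.hadamardAlgebra) :
    centralChar χ (ofCoeff (v ∘ κ)) = ∑ k : C, χ k * ((S.cl k).ncard : ℂ) / χ 1 * v k := by
  classical
  rw [centralChar_apply, ← Finset.sum_fiberwise Finset.univ κ, Finset.sum_div]
  refine Finset.sum_congr rfl fun k _ => ?_
  have hterm : ∀ g ∈ Finset.univ.filter fun g => κ g = k,
      (ofCoeff (v ∘ κ)).coeff g * χ g = v k * χ k := fun g hg => by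
    have hg := (Finset.mem_filter.1 hg).2
    rw [coeff_ofCoeff, Function.comp_apply, hg,
      mem_cl_iff.1 ((apply_eq_iff_mem_cl hC hκ g k).1 hg) χ hχ]
  rw [Finset.sum_congr rfl hterm, Finset.sum_const, nsmul_eq_mul, ncard_cl_eq_card_fiber hC hκ]
  ring

theorem norm_ofCoeff_comp (hC : S.IsClassReps C) (hκ : ∀ g, (κ g : G) ∈ S.cl g) (v : C → ℂ) :
    Algebra.norm ℂ (ofCoeff (v ∘ κ)) = ∏ χ ∈ S.finite_basicChars.toFinset,
      (∑ k : C, χ k * ((S.cl k).ncard : ℂ) / χ 1 * v k) ^ degree χ := by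
  rw [norm_eq_prod_basicChars (mem_hadamardAlgebra.1 (comp_mem_hadamardAlgebra hC hκ v))]
  refine Finset.prod_congr rfl fun χ hχ => ?_
  obtain ⟨ψ, rfl⟩ := basicChars_eq_range.subset (S.finite_basicChars.mem_toFinset.1 hχ)
  rw [centralChar_ofCoeff_comp hC hκ v (basicChar_mem_hadamardAlgebra ψ)]

end ClassReps

end SupercharacterTheory

theorem theoremA {G : Type*} [Group G] [Fintype G] [DecidableEq G]
    (S : SupercharacterTheory G) (C : Finset G) (hC : S.IsClassReps C)
    (κ : G → C) (hκ : ∀ g : G, (κ g : G) ∈ S.cl g) :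
    Matrix.det (Matrix.of fun g h : G => (MvPolynomial.X (κ (g * h⁻¹)) : MvPolynomial C ℂ)) =
      ∏ χ ∈ S.finite_basicChars.toFinset,
        (∑ g : C, MvPolynomial.C (χ g * ((S.cl g).ncard : ℂ) / χ 1) * MvPolynomial.X g) ^
          SupercharacterTheory.degree χ := by
  refine MvPolynomial.funext fun v => ?_
  have hdet : MvPolynomial.eval v (Matrix.det (Matrix.of fun g h : G =>
      (MvPolynomial.X (κ (g * h⁻¹)) : MvPolynomial C ℂ))) =
      Algebra.norm ℂ (ofCoeff (v ∘ κ)) := by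
    rw [norm_eq_det_coeff, RingHom.map_det]
    congr 1
    ext g h
    simp
  rw [hdet, SupercharacterTheory.norm_ofCoeff_comp hC hκ v, map_prod]
  exact Finset.prod_congr rfl fun χ _ => by simp
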